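/- **Theorem 2 (Bisimulation-Based Suboptimality Bounds for Multitask Optimal LQR).** Consider $N$ linear systems $x^{(i)}_{t+1}=A^{(i)}x^{(i)}_t+B^{(i)}u^{(i)}_t$, $i=1,\dots,N$, with states in $\mathbb R^{d_x}$ and inputs in $\mathbb R^{d_u}$, whose initial states $x^{(i)}_0$ are zero-mean, square-integrable random vectors with covariance $\Sigma^{(i)}_0\succ0$. Let $Q^{(i)}\succeq0$ and $R^{(i)}\succ0$ be symmetric. For $K\in\mathbb R^{d_u\times d_x}$ put $A^{(i)}_K=A^{(i)}-B^{(i)}K$; let $\mathcal K^{(i)}_{\rm stab}=\{K:\rho(A^{(i)}_K)<1\}$, where $\rho$ is the spectral radius, and $\mathcal K_{\rm stab}=\bigcap_i\mathcal K^{(i)}_{\rm stab}$. With $u^{(i)}_t=-Kx^{(i)}_t$, let $$J^{(i)}(K)=\mathbf E\Big[\sum_{t\ge0}x_t^{(i)\top}\big(Q^{(i)}+K^\top R^{(i)}K\big)x^{(i)}_t\Big],\qquad \Sigma^{(i)}_K=\mathbf E\Big[\sum_{t\ge0}x^{(i)}_tx_t^{(i)\top}\Big],\qquad J_{\rm avg}=\frac1N\sum_{i=1}^N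 J^{(i)} .$$ For $K\in\mathcal K_{\rm stab}$ let $P^{(i)}_K$ be the unique solution of $P-A_K^{(i)\top}PA_K^{(i)}=Q^{(i)}+K^\top R^{(i)}K$, and let $E^{(i)}_K=2\big((R^{(i)}+B^{(i)\top}P^{(i)}_KB^{(i)})K-B^{(i)\top}P^{(i)}_KA^{(i)}\big)$. For $i\ne j$ put $E^{(ij)}_K=[E^{(i)}_K\;\;-E^{(j)}_K]$, $A^{(ij)}_K=\mathrm{diag}(A^{(i)}_K,A^{(j)}_K)$ and $$b_{ij}(K)=\inf_{M,\lambda}\;\frac{\sqrt2\,\mathrm{tr}\big(M\,\mathrm{diag}(\Sigma^{(i)}_0,\Sigma^{(j)}_0)\big)}{\lambda\sqrt{\lambda_{\min}(M)}},\qquad b_i(K)=\frac1N\sum_{j\ne i}b_{ij}(K),$$ where the infimum is over all $\lambda\in(0,1)$ and symmetric positive definite $M\in\mathbb R^{2d_x\times2d_x}$ with $M\succeq E_K^{(ij)\top}E^{(ij)}_K$ and $A_K^{(ij)\top}MA^{(ij)}_K-M\preceq-\lambda M$. Let $K_\star\in\mathcal K_{\rm stab}$ minimize $J_{\rm avg}$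 over $\mathcal K_{\rm stab}$. Then, for each task $i$ and each minimizer $K^{(i)}_\star$ of $J^{(i)}$ over $\mathcal K^{(i)}_{\rm stab}$, $$J^{(i)}(K_\star)-J^{(i)}(K^{(i)}_\star)\le\frac{2\,\big\|\Sigma^{(i)}_{K^{(i)}_\star}\big\|\,b_i(K_\star)^2}{\lambda_{\min}(\Sigma^{(i)}_0)^2\,\sigma_{\min}(R^{(i)})},$$ where $\|\cdot\|$ is the spectral norm, $\lambda_{\min}$ the smallest eigenvalue and $\sigma_{\min}$ the smallest singular value. -/

import Mathlib

open MeasureTheory ProbabilityTheory Matrix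

noncomputable section

/-- The smallest eigenvalue `λ_min(M)` of a real symmetric matrix. -/
def lambdaMin {ι : Type} [Fintype ι] [DecidableEq ι] (M : Matrix ι ι ℝ) : ℝ :=
  sInf (spectrum ℝ M)

/-- The smallest singular value `σ_min(M)` of a square matrix. Mathlib lists the singular values
in decreasing order, starting from index `0`. -/
def sigmaMin {n : ℕ} (M : Matrix (Fin n) (Fin n) ℝ) : ℝ :=
  (Matrix.toEuclideanLin M).singularValues (n - 1)

/-- The spectral norm of a square matrix (operator norm for the Euclidean vector norm). -/
def spectralNorm2 {n : ℕ} (M : Matrix (Fin n) (Fin n) ℝ) : ℝ :=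
  ‖Matrix.toEuclideanCLM (n := Fin n) (𝕜 := ℝ) M‖

/-- Discrete-time asymptotic stability: every complex eigenvalue lies in the open unit disk. -/
def IsSchurStable {n : ℕ} (M : Matrix (Fin n) (Fin n) ℝ) : Prop :=
  spectralRadius ℂ (M.map (algebraMap ℝ ℂ)) < 1

/-- An LQR task `(A, B, Q, R)` with state dimension `dx` and input dimension `du`,
where `Q ⪰ 0` and `R ≻ 0` (both symmetric). -/
structure LQRTask (dx du : ℕ) where
  A : Matrix (Fin dx) (Fin dx) ℝ
  B : Matrix (Fin dx) (Fin du) ℝ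
  Q : Matrix (Fin dx) (Fin dx) ℝ
  R : Matrix (Fin du) (Fin du) ℝ
  posSemidef_Q : Q.PosSemidef
  posDef_R : R.PosDef

namespace LQRTask

variable {dx du : ℕ}

/-- The closed-loop state trajectory: `x_{t+1} = A x_t + B u_t` with `u_t = -K x_t`. -/
def traj (T : LQRTask dx du) (K : Matrix (Fin du) (Fin dx) ℝ) (x : Fin dx → ℝ) :
    ℕ → Fin dx → ℝ
  | 0 => x
  | t + 1 => T.A *ᵥ traj T K x t + T.B *ᵥ (-(K *ᵥ traj T K x t))

/-- The closed-loop matrix `A_K = A - B K`. -/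
def closedLoop (T : LQRTask dx du) (K : Matrix (Fin du) (Fin dx) ℝ) :
    Matrix (Fin dx) (Fin dx) ℝ :=
  T.A - T.B * K

/-- The set of stabilizing controllers of the task. -/
def stabilizing (T : LQRTask dx du) : Set (Matrix (Fin du) (Fin dx) ℝ) :=
  {K | IsSchurStable (T.closedLoop K)}

/-- The closed-loop stage cost matrix `Q + Kᵀ R K`. -/
def stageCost (T : LQRTask dx du) (K : Matrix (Fin du) (Fin dx) ℝ) :
    Matrix (Fin dx) (Fin dx) ℝ :=
  T.Q + Kᵀ * T.R * K

/-- The LQR cost `J(K) = E[∑ₜ xₜᵀ (Q + Kᵀ R K) xₜ]` for the random initial state `x₀`.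
It is only ever evaluated at stabilizing `K` and square-integrable `x₀`, where the series converges
pointwise and its sum is integrable. -/
def cost (T : LQRTask dx du) {Ω : Type*} [MeasurableSpace Ω] (μ : Measure Ω)
    (x₀ : Ω → Fin dx → ℝ) (K : Matrix (Fin du) (Fin dx) ℝ) : ℝ :=
  ∫ ω, ∑' t : ℕ, T.traj K (x₀ ω) t ⬝ᵥ (T.stageCost K *ᵥ T.traj K (x₀ ω) t) ∂μ

/-- The state covariance `Σ_K = E[∑ₜ xₜ xₜᵀ]`, entry by entry. -/
def stateCov (T : LQRTask dx du) {Ω : Type*} [MeasurableSpace Ω] (μ : Measure Ω)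
    (x₀ : Ω → Fin dx → ℝ) (K : Matrix (Fin du) (Fin dx) ℝ) : Matrix (Fin dx) (Fin dx) ℝ :=
  Matrix.of fun a b => ∫ ω, ∑' t : ℕ, T.traj K (x₀ ω) t a * T.traj K (x₀ ω) t b ∂μ

/-- `P_K`, the solution `P` of the Lyapunov equation `P - A_Kᵀ P A_K = Q + Kᵀ R K`
(it exists and is unique when `K` is stabilizing). -/
def lyapunovSol (T : LQRTask dx du) (K : Matrix (Fin du) (Fin dx) ℝ) :
    Matrix (Fin dx) (Fin dx) ℝ :=
  Classical.epsilon fun P => P - (T.closedLoop K)ᵀ * P * T.closedLoop K = T.stageCost K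

/-- `E_K = 2 ((R + Bᵀ P_K B) K - Bᵀ P_K A)`. -/
def gradFactor (T : LQRTask dx du) (K : Matrix (Fin du) (Fin dx) ℝ) :
    Matrix (Fin du) (Fin dx) ℝ :=
  (2 : ℝ) • ((T.R + T.Bᵀ * T.lyapunovSol K * T.B) * K - T.Bᵀ * T.lyapunovSol K * T.A)

end LQRTask

/-- The covariance matrix of a random vector. -/
def covMat {n : ℕ} {Ω : Type*} [MeasurableSpace Ω] (μ : Measure Ω) (x : Ω → Fin n → ℝ) :
    Matrix (Fin n) (Fin n) ℝ :=
  Matrix.of fun a b => cov[fun ω => x ω a, fun ω => x ω b; μ]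

section Pair

variable {dx du : ℕ}

/-- `E_K^{(ij)} = [E_K^{(i)}  -E_K^{(j)}]`. -/
def pairGradFactor (T T' : LQRTask dx du) (K : Matrix (Fin du) (Fin dx) ℝ) :
    Matrix (Fin du) (Fin dx ⊕ Fin dx) ℝ :=
  Matrix.fromCols (T.gradFactor K) (-(T'.gradFactor K))

/-- `A_K^{(ij)} = diag(A_K^{(i)}, A_K^{(j)})`. -/
def pairClosedLoop (T T' : LQRTask dx du) (K : Matrix (Fin du) (Fin dx) ℝ) :
    Matrix (Fin dx ⊕ Fin dx) (Fin dx ⊕ Fin dx) ℝ :=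
  Matrix.fromBlocks (T.closedLoop K) 0 0 (T'.closedLoop K)

/-- The pairs `(M, λ)` that satisfy the two linear matrix inequalities: `M ≻ 0`, `0 < λ < 1`,
`M ⪰ Eᵀ E` and `Aᵀ M A - M ⪯ -λ M`, with `E = E_K^{(ij)}` and `A = A_K^{(ij)}`. -/
def BisimFeasible (T T' : LQRTask dx du) (K : Matrix (Fin du) (Fin dx) ℝ)
    (M : Matrix (Fin dx ⊕ Fin dx) (Fin dx ⊕ Fin dx) ℝ) (lam : ℝ) : Prop :=
  M.PosDef ∧ 0 < lam ∧ lam < 1 ∧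
    (M - (pairGradFactor T T' K)ᵀ * pairGradFactor T T' K).PosSemidef ∧
    (-(lam • M) -
      ((pairClosedLoop T T' K)ᵀ * M * pairClosedLoop T T' K - M)).PosSemidef

/-- The bisimulation bound `√2 tr(M diag(S, S')) / (λ √(λ_min(M)))`, where `S` and `S'` are
the initial covariances of the two tasks. -/
def bisimBound (S S' : Matrix (Fin dx) (Fin dx) ℝ)
    (M : Matrix (Fin dx ⊕ Fin dx) (Fin dx ⊕ Fin dx) ℝ) (lam : ℝ) : ℝ :=
  √2 * (M * Matrix.fromBlocks S 0 0 S').trace / (lam * √(lambdaMin M))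

/-- The bisimulation-based heterogeneity `b_{ij}(K)` of two tasks: the optimal value (infimum) of
the bisimulation bound over all feasible `(M, λ)`. It is the value at a minimizer whenever
a minimizer exists. -/
def bisimHet (T T' : LQRTask dx du) (S S' : Matrix (Fin dx) (Fin dx) ℝ)
    (K : Matrix (Fin du) (Fin dx) ℝ) : ℝ :=
  sInf {v | ∃ M lam, BisimFeasible T T' K M lam ∧ v = bisimBound S S' M lam}

end Pair

section Multitask

variable {N dx du : ℕ}

/-- The set of common stabilizing controllers. -/
def commonStabilizing (T : Fin N → LQRTask dx du) : Set (Matrix (Fin du) (Fin dx) ℝ) :=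
  ⋂ i, (T i).stabilizing

/-- The average cost `J_avg(K) = (1/N) ∑ᵢ J^{(i)}(K)`. -/
def avgCost (T : Fin N → LQRTask dx du) {Ω : Type*} [MeasurableSpace Ω] (μ : Measure Ω)
    (x₀ : Fin N → Ω → Fin dx → ℝ) (K : Matrix (Fin du) (Fin dx) ℝ) : ℝ :=
  (1 / (N : ℝ)) * ∑ i, (T i).cost μ (x₀ i) K

/-- The average heterogeneity `b_i(K) = (1/N) ∑_{j ≠ i} b_{ij}(K)`, where `S j` is
the initial covariance of task `j`. -/
def avgBisimHet (T : Fin N → LQRTask dx du) (S : Fin N → Matrix (Fin dx) (Fin dx) ℝ)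
    (i : Fin N) (K : Matrix (Fin du) (Fin dx) ℝ) : ℝ :=
  (1 / (N : ℝ)) * ∑ j ∈ Finset.univ.erase i, bisimHet (T i) (T j) (S i) (S j) K

end Multitask

end

/-!
For stabilizing `K` the closed-loop powers decay geometrically (Gelfand's formula), so the Lyapunov
series `lyapSum A X = ∑ₜ Aᵗ X (Aᵗ)ᵀ` converges and is the unique solution of `Y = X + A Y Aᵀ`.
Taking expectations through linear functionals gives `Σ_K = lyapSum A_K Σ₀` and
`J(K) = tr((Q + Kᵀ R K) Σ_K)`. Everything then rests on one identity, the cost difference formula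
`LQRTask.trace_cost_sub`: with `Δ = K' - K`,
`J(K') - J(K) = tr((Δᵀ E_K + Δᵀ (R + Bᵀ P_K B) Δ) Σ_{K'})`.

* To first order it shows that the gradient of `J` is `E_K Σ_K`. As stability is an open condition
  and `Σ_K` depends continuously on `K`, the sum of these gradients vanishes at the minimizer
  `K⋆` of the average cost (`sum_gradFactor_mul_lyapSum_eq_zero`). Hence the gradient of task `i` at
  `K⋆` is the average over `j` of its differences with the gradients of the tasks `j`.
* Each difference is `E W [I; I]` for the pair system, with `W = diag(Σ_K⁽ⁱ⁾, Σ_K⁽ʲ⁾)`. For feasible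
  `(M, λ)`, `M ⪰ Eᵀ E` gives `‖E W‖_F ≤ tr(M W) / √λ_min(M)`, and the Lyapunov inequality gives
  `λ tr(M W) ≤ tr(M diag(Σ₀⁽ⁱ⁾, Σ₀⁽ʲ⁾))` (`BisimFeasible.norm_sub_le`). Feasible pairs exist
  (`exists_bisimFeasible`), so the difference is at most the infimum `b_ij` and the gradient of
  task `i` is at most `b_i` (`norm_gradient_le_avgBisimHet`).
* Completing the square in the cost difference formula bounds the suboptimality gap by
  `‖Σ_{K'}‖ ‖E_K‖_F² / (4 σ_min(R))` (`LQRTask.trace_cost_sub_le`), and `Σ_K ⪰ Σ₀` gives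
  `λ_min(Σ₀) ‖E_K‖_F ≤ ‖E_K Σ_K‖_F` (`lambdaMin_mul_norm_le`).

The result is the claimed bound, with the constant `1/4` in place of `2`.
-/

noncomputable section

/-! ### Schur stability and decay of powers -/

/-- The powers of `A` decay geometrically, entry by entry. For `Fin n`-indexed matrices this follows
from `IsSchurStable`; unlike that predicate it makes sense over every finite index type, in
particular over the sum type that indexes block matrices. -/
def PowDecay {ι : Type*} [Fintype ι] [DecidableEq ι] (A : Matrix ι ι ℝ) : Prop :=
  ∃ r : ℝ, 0 ≤ r ∧ r < 1 ∧ ∀ a b, (fun t : ℕ => (A ^ t) a b) =O[Filter.atTop] fun t => r ^ t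

section Stability

attribute [local instance] Matrix.linftyOpNormedRing Matrix.linftyOpNormedAlgebra

variable {n : ℕ}

lemma abs_entry_le_linftyOpNorm_map (M : Matrix (Fin n) (Fin n) ℝ) (a b : Fin n) :
    |M a b| ≤ ‖M.map (algebraMap ℝ ℂ)‖ := by
  rw [Matrix.linfty_opNorm_def]
  have h1 : ‖(M.map (algebraMap ℝ ℂ)) a b‖₊ ≤ ∑ j, ‖(M.map (algebraMap ℝ ℂ)) a j‖₊ :=
    Finset.single_le_sum (f := fun j => ‖(M.map (algebraMap ℝ ℂ)) a j‖₊) (fun _ _ => zero_le)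
      (Finset.mem_univ b)
  have h2 := h1.trans (Finset.le_sup (f := fun i => ∑ j, ‖(M.map (algebraMap ℝ ℂ)) i j‖₊)
      (Finset.mem_univ a))
  have h3 : |M a b| = ((‖(M.map (algebraMap ℝ ℂ)) a b‖₊ : NNReal) : ℝ) := by simp
  rw [h3]
  exact_mod_cast h2

lemma linftyOpNorm_map_le_sum_abs (M : Matrix (Fin n) (Fin n) ℝ) :
    ‖M.map (algebraMap ℝ ℂ)‖ ≤ ∑ a, ∑ b, |M a b| := by
  rw [Matrix.linfty_opNorm_def]
  have h : (Finset.univ.sup fun i => ∑ j, ‖(M.map (algebraMap ℝ ℂ)) i j‖₊) ≤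
      ∑ i, ∑ j, ‖(M.map (algebraMap ℝ ℂ)) i j‖₊ :=
    Finset.sup_le fun i _ =>
      Finset.single_le_sum (f := fun i => ∑ j, ‖(M.map (algebraMap ℝ ℂ)) i j‖₊)
        (fun _ _ => zero_le) (Finset.mem_univ i)
  have h' := NNReal.coe_le_coe.2 h
  refine h'.trans (le_of_eq ?_)
  simp

/-- Gelfand's formula: the powers of a Schur stable matrix decay geometrically. -/
lemma IsSchurStable.powDecay {M : Matrix (Fin n) (Fin n) ℝ} (hM : IsSchurStable M) :
    PowDecay M := by
  have : CompleteSpace (Matrix (Fin n) (Fin n) ℂ) := FiniteDimensional.complete ℂ _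
  obtain ⟨r, hr, hr1⟩ := ENNReal.lt_iff_exists_nnreal_btwn.1 hM
  refine ⟨r, r.2, by exact_mod_cast hr1, fun a b => ?_⟩
  have hlim := spectrum.pow_nnnorm_pow_one_div_tendsto_nhds_spectralRadius
    (M.map (algebraMap ℝ ℂ))
  refine Asymptotics.IsBigO.of_bound 1 ?_
  filter_upwards [hlim.eventually_lt_const hr, Filter.eventually_gt_atTop 0] with t ht ht0
  have h1 : ‖(M.map (algebraMap ℝ ℂ)) ^ t‖₊ ≤ r ^ t := by
    have h2 := ENNReal.rpow_le_rpow ht.le (Nat.cast_nonneg (α := ℝ) t)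
    rw [← ENNReal.rpow_mul, one_div, inv_mul_cancel₀ (by positivity), ENNReal.rpow_one,
      ENNReal.rpow_natCast] at h2
    exact_mod_cast h2
  have h3 : (M ^ t).map (algebraMap ℝ ℂ) = (M.map (algebraMap ℝ ℂ)) ^ t :=
    Matrix.map_pow M (algebraMap ℝ ℂ) t
  have h4 := abs_entry_le_linftyOpNorm_map (M ^ t) a b
  rw [h3] at h4
  have h5 : ‖(M.map (algebraMap ℝ ℂ)) ^ t‖ ≤ (r : ℝ) ^ t := by exact_mod_cast h1
  have h6 : ‖(r : ℝ) ^ t‖ = (r : ℝ) ^ t := by simp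
  rw [h6, one_mul]
  exact h4.trans h5

lemma isSchurStable_of_sum_abs_pow_lt_one {M : Matrix (Fin n) (Fin n) ℝ} {k : ℕ}
    (h : ∑ a, ∑ b, |(M ^ (k + 1)) a b| < 1) : IsSchurStable M := by
  rcases isEmpty_or_nonempty (Fin n) with hn | hn
  · have : Subsingleton (Matrix (Fin n) (Fin n) ℂ) := inferInstance
    simp [IsSchurStable, spectrum.SpectralRadius.of_subsingleton]
  have : CompleteSpace (Matrix (Fin n) (Fin n) ℂ) := FiniteDimensional.complete ℂ _
  refine lt_of_le_of_lt (spectrum.spectralRadius_le_pow_nnnorm_pow_one_div ℂ _ k) ?_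
  have h3 : (M ^ (k + 1)).map (algebraMap ℝ ℂ) = (M.map (algebraMap ℝ ℂ)) ^ (k + 1) :=
    Matrix.map_pow M (algebraMap ℝ ℂ) (k + 1)
  have h4 := (linftyOpNorm_map_le_sum_abs (M ^ (k + 1))).trans_lt h
  rw [h3] at h4
  have h5 : ‖(M.map (algebraMap ℝ ℂ)) ^ (k + 1)‖₊ < 1 := by exact_mod_cast h4
  rw [nnnorm_one]
  simp only [ENNReal.coe_one, ENNReal.one_rpow, mul_one]
  exact ENNReal.rpow_lt_one (by exact_mod_cast h5) (by positivity)

lemma PowDecay.tendsto_zero {ι : Type*} [Fintype ι] [DecidableEq ι] {A : Matrix ι ι ℝ}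
    (hA : PowDecay A) (a b : ι) :
    Filter.Tendsto (fun t : ℕ => (A ^ t) a b) Filter.atTop (nhds 0) := by
  obtain ⟨r, hr0, hr1, h⟩ := hA
  exact (h a b).trans_tendsto (tendsto_pow_atTop_nhds_zero_of_lt_one hr0 hr1)

/-- Schur stability is an open condition: it says that some positive power has small entries. -/
lemma isOpen_setOf_isSchurStable :
    IsOpen {M : Matrix (Fin n) (Fin n) ℝ | IsSchurStable M} := by
  have hset : {M : Matrix (Fin n) (Fin n) ℝ | IsSchurStable M} =
      ⋃ k : ℕ, {M | ∑ a, ∑ b, |(M ^ (k + 1)) a b| < 1} := by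
    ext M
    simp only [Set.mem_ofPred_eq, Set.mem_iUnion]
    refine ⟨fun hM => ?_, fun ⟨k, hk⟩ => isSchurStable_of_sum_abs_pow_lt_one hk⟩
    have h0 : Filter.Tendsto (fun t : ℕ => ∑ a, ∑ b, |(M ^ t) a b|) Filter.atTop (nhds 0) := by
      have := tendsto_finsetSum (Finset.univ : Finset (Fin n)) fun a _ =>
        tendsto_finsetSum (Finset.univ : Finset (Fin n)) fun b _ =>
          (hM.powDecay.tendsto_zero a b).abs
      simpa using this
    exact (((Filter.tendsto_add_atTop_iff_nat 1).2 h0).eventually_lt_const one_pos).exists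
  rw [hset]
  refine isOpen_iUnion fun k => isOpen_lt ?_ continuous_const
  refine continuous_finsetSum _ fun a _ => continuous_finsetSum _ fun b _ => ?_
  exact ((continuous_pow (M := Matrix (Fin n) (Fin n) ℝ) (k + 1)).matrix_elem a b).abs

end Stability

section PowDecay

variable {ι κ : Type*} [Fintype ι] [DecidableEq ι] [Fintype κ] [DecidableEq κ]

lemma PowDecay.transpose {A : Matrix ι ι ℝ} (hA : PowDecay A) : PowDecay Aᵀ := by
  obtain ⟨r, hr0, hr1, h⟩ := hA
  refine ⟨r, hr0, hr1, fun a b => ?_⟩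
  simpa [← Matrix.transpose_pow] using h b a

lemma PowDecay.fromBlocks {A : Matrix ι ι ℝ} {B : Matrix κ κ ℝ} (hA : PowDecay A)
    (hB : PowDecay B) : PowDecay (Matrix.fromBlocks A 0 0 B) := by
  obtain ⟨r, hr0, hr1, h⟩ := hA
  obtain ⟨s, hs0, hs1, h'⟩ := hB
  have mono : ∀ {x y : ℝ}, 0 ≤ x → x ≤ y →
      (fun t : ℕ => x ^ t) =O[Filter.atTop] fun t => y ^ t := fun {x y} hx hxy =>
    Asymptotics.IsBigO.of_bound 1 (.of_forall fun t => by
      have := pow_le_pow_left₀ hx hxy t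
      simpa [abs_of_nonneg hx, abs_of_nonneg (hx.trans hxy)] using this)
  refine ⟨max r s, le_max_of_le_left hr0, max_lt hr1 hs1, fun a b => ?_⟩
  simp only [Matrix.fromBlocks_diagonal_pow]
  rcases a with a | a <;> rcases b with b | b
  · simpa using (h a b).trans (mono hr0 (le_max_left r s))
  · simpa using Asymptotics.isBigO_zero _ _
  · simpa using Asymptotics.isBigO_zero _ _
  · simpa using (h' a b).trans (mono hs0 (le_max_right r s))

end PowDecay

/-! ### The discrete Lyapunov equation -/

/-- The Lyapunov series `∑ₜ Aᵗ X (Aᵗ)ᵀ`, entry by entry. When the powers of `A` decay, it is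
the unique solution `Y` of `Y = X + A Y Aᵀ`. -/
def lyapSum {ι : Type*} [Fintype ι] [DecidableEq ι] (A X : Matrix ι ι ℝ) : Matrix ι ι ℝ :=
  Matrix.of fun a b => ∑' t : ℕ, (A ^ t * X * (A ^ t)ᵀ) a b

section Lyapunov

variable {ι : Type*} [Fintype ι] [DecidableEq ι] {A : Matrix ι ι ℝ}

lemma PowDecay.isBigO_conj (hA : PowDecay A) : ∃ r : ℝ, 0 ≤ r ∧ r < 1 ∧
    ∀ (X : Matrix ι ι ℝ) a b, (fun t : ℕ => (A ^ t * X * (A ^ t)ᵀ) a b) =O[Filter.atTop]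
      fun t => r ^ t := by
  obtain ⟨r, hr0, hr1, h⟩ := hA
  refine ⟨r * r, by positivity, by nlinarith, fun X a b => ?_⟩
  simp only [Matrix.mul_apply, Matrix.transpose_apply, mul_pow]
  refine Asymptotics.IsBigO.fun_sum fun d _ => Asymptotics.IsBigO.mul ?_ (h b d)
  refine Asymptotics.IsBigO.fun_sum fun c _ => ?_
  simpa only [mul_comm] using (h a c).const_mul_left (X c d)

lemma PowDecay.summable_conj (hA : PowDecay A) (X : Matrix ι ι ℝ) (a b : ι) :
    Summable fun t : ℕ => (A ^ t * X * (A ^ t)ᵀ) a b := by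
  obtain ⟨r, hr0, hr1, h⟩ := hA.isBigO_conj
  exact summable_of_isBigO_nat (summable_geometric_of_lt_one hr0 hr1) (h X a b)

lemma PowDecay.tendsto_conj_zero (hA : PowDecay A) (X : Matrix ι ι ℝ) (a b : ι) :
    Filter.Tendsto (fun t : ℕ => (A ^ t * X * (A ^ t)ᵀ) a b) Filter.atTop (nhds 0) :=
  (hA.summable_conj X a b).tendsto_atTop_zero

lemma PowDecay.hasSum_conj (hA : PowDecay A) (X : Matrix ι ι ℝ) :
    HasSum (fun t : ℕ => A ^ t * X * (A ^ t)ᵀ) (lyapSum A X) :=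
  Pi.hasSum.2 fun a => Pi.hasSum.2 fun b => (hA.summable_conj X a b).hasSum

lemma PowDecay.lyapSum_add (hA : PowDecay A) (X Y : Matrix ι ι ℝ) :
    lyapSum A (X + Y) = lyapSum A X + lyapSum A Y := by
  refine (hA.hasSum_conj (X + Y)).unique ?_
  simpa [mul_add, add_mul] using (hA.hasSum_conj X).add (hA.hasSum_conj Y)

lemma lyapSum_smul (c : ℝ) (X : Matrix ι ι ℝ) :
    lyapSum A (c • X) = c • lyapSum A X := by
  ext a b
  simp [lyapSum, tsum_mul_left]

/-- The Lyapunov equation. -/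
lemma PowDecay.lyapSum_eq (hA : PowDecay A) (X : Matrix ι ι ℝ) :
    lyapSum A X = X + A * lyapSum A X * Aᵀ := by
  have h1 : HasSum (fun t : ℕ => A * (A ^ t * X * (A ^ t)ᵀ) * Aᵀ) (A * lyapSum A X * Aᵀ) :=
    (hA.hasSum_conj X).map ((AddMonoidHom.mulRight Aᵀ).comp (AddMonoidHom.mulLeft A))
      (by
        change Continuous fun Y : Matrix ι ι ℝ => A * Y * Aᵀ
        fun_prop)
  have h2 := (hasSum_nat_add_iff' 1).2 (hA.hasSum_conj X)
  have h3 : (fun t : ℕ => A ^ (t + 1) * X * (A ^ (t + 1))ᵀ) =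
      fun t : ℕ => A * (A ^ t * X * (A ^ t)ᵀ) * Aᵀ := by
    funext t
    rw [pow_succ' A t, Matrix.transpose_mul]
    simp only [Matrix.mul_assoc]
  rw [h3] at h2
  have h4 := h2.unique h1
  simp only [Finset.range_one, Finset.sum_singleton, pow_zero, one_mul, Matrix.transpose_one,
    mul_one] at h4
  rw [← h4]
  abel

lemma PowDecay.eq_zero_of_eq_conj (hA : PowDecay A) {Y : Matrix ι ι ℝ} (hY : Y = A * Y * Aᵀ) :
    Y = 0 := by
  have h : ∀ t : ℕ, A ^ t * Y * (A ^ t)ᵀ = Y := by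
    intro t
    induction t with
    | zero => simp
    | succ t ih =>
      rw [pow_succ A t, Matrix.transpose_mul]
      calc A ^ t * A * Y * (Aᵀ * (A ^ t)ᵀ) = A ^ t * (A * Y * Aᵀ) * (A ^ t)ᵀ := by
            simp only [Matrix.mul_assoc]
        _ = Y := by rw [← hY, ih]
  ext a b
  have h1 := hA.tendsto_conj_zero Y a b
  simp only [h] at h1
  simpa using tendsto_nhds_unique tendsto_const_nhds h1

lemma PowDecay.eq_lyapSum (hA : PowDecay A) {X Y : Matrix ι ι ℝ} (hY : Y = X + A * Y * Aᵀ) :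
    Y = lyapSum A X := by
  have h := hA.lyapSum_eq X
  rw [← sub_eq_zero]
  refine hA.eq_zero_of_eq_conj ?_
  conv_lhs => rw [hY, h]
  rw [mul_sub, sub_mul]
  abel

lemma PowDecay.posSemidef_lyapSum (hA : PowDecay A) {X : Matrix ι ι ℝ} (hX : X.PosSemidef) :
    (lyapSum A X).PosSemidef := by
  refine Matrix.PosSemidef.of_dotProduct_mulVec_nonneg ?_ fun v => ?_
  · ext a b
    simp only [Matrix.conjTranspose_apply, lyapSum, Matrix.of_apply, star_trivial]
    refine tsum_congr fun t => ?_
    have := (hX.mul_mul_conjTranspose_same (A ^ t)).isHermitian.apply a b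
    simpa [Matrix.conjTranspose_eq_transpose_of_trivial] using this
  · have h : HasSum (fun t : ℕ => star v ⬝ᵥ ((A ^ t * X * (A ^ t)ᵀ) *ᵥ v))
        (star v ⬝ᵥ (lyapSum A X *ᵥ v)) := by
      refine (hA.hasSum_conj X).map
        (⟨⟨fun Y => star v ⬝ᵥ (Y *ᵥ v), by simp⟩, fun Y Z => by
          simp [Matrix.add_mulVec]⟩ : Matrix ι ι ℝ →+ ℝ) ?_
      change Continuous fun Y : Matrix ι ι ℝ => star v ⬝ᵥ (Y *ᵥ v)
      fun_prop
    refine h.nonneg fun t => ?_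
    have := (hX.mul_mul_conjTranspose_same (A ^ t)).dotProduct_mulVec_nonneg v
    simpa [Matrix.conjTranspose_eq_transpose_of_trivial] using this

lemma PowDecay.posSemidef_lyapSum_sub (hA : PowDecay A) {X : Matrix ι ι ℝ} (hX : X.PosSemidef) :
    (lyapSum A X - X).PosSemidef := by
  have h := hA.lyapSum_eq X
  have h2 := (hA.posSemidef_lyapSum hX).mul_mul_conjTranspose_same A
  rw [Matrix.conjTranspose_eq_transpose_of_trivial] at h2
  rwa [show lyapSum A X - X = A * lyapSum A X * Aᵀ by conv_lhs => { rw [h] }; abel]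

/-- Trace duality: pairing a Lyapunov solution `Y` for `A` with the defect `P - Aᵀ P A` recovers
the pairing of `P` with the source term. -/
lemma PowDecay.trace_mul_lyapSum (hA : PowDecay A) (P X : Matrix ι ι ℝ) :
    ((P - Aᵀ * P * A) * lyapSum A X).trace = (P * X).trace := by
  have h := hA.lyapSum_eq X
  have h2 : (Aᵀ * P * A * lyapSum A X).trace = (P * (A * lyapSum A X * Aᵀ)).trace := by
    rw [show Aᵀ * P * A * lyapSum A X = Aᵀ * (P * A * lyapSum A X) by
      simp only [Matrix.mul_assoc], Matrix.trace_mul_comm]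
    simp only [Matrix.mul_assoc]
  rw [sub_mul, Matrix.trace_sub, h2, ← Matrix.trace_sub, ← mul_sub]
  rw [sub_eq_of_eq_add h]

open scoped Kronecker in
/-- The solution of the Lyapunov equation depends continuously on `A`: in vectorized form it is
`(1 - A ⊗ A)⁻¹ vec X`. -/
lemma tendsto_lyapSum {α : Type*} {l : Filter α} {B : α → Matrix ι ι ℝ}
    (hA : PowDecay A) (hB : ∀ᶠ s in l, PowDecay (B s)) (hlim : Filter.Tendsto B l (nhds A))
    (X : Matrix ι ι ℝ) :
    Filter.Tendsto (fun s => lyapSum (B s) X) l (nhds (lyapSum A X)) := by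
  have hsys : ∀ C : Matrix ι ι ℝ, PowDecay C →
      (1 - C ⊗ₖ C) *ᵥ (lyapSum C X).vec = X.vec := fun C hC => by
    rw [Matrix.sub_mulVec, Matrix.one_mulVec, Matrix.kronecker_mulVec_vec, ← Matrix.vec_sub]
    rw [sub_eq_of_eq_add (hC.lyapSum_eq X)]
  have hdet : ∀ C : Matrix ι ι ℝ, PowDecay C → (1 - C ⊗ₖ C).det ≠ 0 := by
    intro C hC h0
    obtain ⟨v, hv, hv0⟩ := Matrix.exists_mulVec_eq_zero_iff.2 h0
    refine hv ?_
    obtain ⟨Y, rfl⟩ : ∃ Y : Matrix ι ι ℝ, Y.vec = v := ⟨Matrix.of fun a b => v (b, a), rfl⟩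
    rw [Matrix.sub_mulVec, Matrix.one_mulVec, Matrix.kronecker_mulVec_vec, ← Matrix.vec_sub,
      Matrix.vec_eq_zero_iff, sub_eq_zero] at hv0
    rw [hC.eq_zero_of_eq_conj hv0, Matrix.vec_zero]
  have hsol : ∀ C : Matrix ι ι ℝ, PowDecay C →
      (lyapSum C X).vec = (1 - C ⊗ₖ C)⁻¹ *ᵥ X.vec := fun C hC => by
    have hu : IsUnit (1 - C ⊗ₖ C).det := (hdet C hC).isUnit
    rw [← hsys C hC, Matrix.mulVec_mulVec, Matrix.nonsing_inv_mul _ hu, Matrix.one_mulVec]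
  have hsys_lim : Filter.Tendsto (fun s => 1 - B s ⊗ₖ B s) l (nhds (1 - A ⊗ₖ A)) := by
    have hc : Continuous fun C : Matrix ι ι ℝ => 1 - C ⊗ₖ C := by
      refine continuous_const.sub (continuous_matrix fun i j => ?_)
      simp only [Matrix.kroneckerMap_apply]
      fun_prop
    exact (hc.tendsto A).comp hlim
  have hinv : Filter.Tendsto (fun s => (1 - B s ⊗ₖ B s)⁻¹) l (nhds (1 - A ⊗ₖ A)⁻¹) := by
    have hca : ContinuousAt (fun C : Matrix (ι × ι) (ι × ι) ℝ => C⁻¹) (1 - A ⊗ₖ A) := by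
      simp only [Matrix.inv_def, Ring.inverse_eq_inv']
      exact (continuous_id.matrix_det.continuousAt.inv₀ (hdet A hA)).smul
        continuous_id.matrix_adjugate.continuousAt
    exact hca.tendsto.comp hsys_lim
  have hvec : Filter.Tendsto (fun s => (lyapSum (B s) X).vec) l (nhds (lyapSum A X).vec) := by
    rw [hsol A hA]
    have hc : Continuous fun C : Matrix (ι × ι) (ι × ι) ℝ => C *ᵥ X.vec := by fun_prop
    refine ((hc.tendsto _).comp hinv).congr' ?_
    filter_upwards [hB] with s hs
    exact (hsol _ hs).symm
  refine tendsto_pi_nhds.2 fun a => tendsto_pi_nhds.2 fun b => ?_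
  exact tendsto_pi_nhds.1 hvec (b, a)

end Lyapunov

/-! ### Costs and covariances as Lyapunov solutions -/

section SecondMoment

variable {n : ℕ} {Ω : Type*} [MeasurableSpace Ω] {μ : Measure Ω} [IsProbabilityMeasure μ]
  {x : Ω → Fin n → ℝ}

lemma covMat_apply_of_integral_eq_zero (hx : MemLp x 2 μ) (hmean : ∫ ω, x ω ∂μ = 0)
    (a b : Fin n) : covMat μ x a b = ∫ ω, x ω a * x ω b ∂μ := by
  have h0 : ∀ c, ∫ ω, x ω c ∂μ = 0 := fun c => by
    have := MeasureTheory.eval_integral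
      (fun c => (hx.eval c).integrable (by norm_num)) c (μ := μ)
    rw [← this, hmean]
    rfl
  rw [covMat, Matrix.of_apply, covariance_eq_sub (hx.eval a) (hx.eval b), h0 a]
  simp

/-- Expectations of linear functions of `x xᵀ` only depend on the covariance of `x`. -/
lemma integral_linear_vecMulVec_self (hx : MemLp x 2 μ) (hmean : ∫ ω, x ω ∂μ = 0)
    (f : Matrix (Fin n) (Fin n) ℝ →ₗ[ℝ] ℝ) :
    ∫ ω, f (Matrix.vecMulVec (x ω) (x ω)) ∂μ = f (covMat μ x) := by
  have hf : ∀ X, f X = ∑ a, ∑ b, X a b * f (Matrix.single a b 1) := fun X => by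
    conv_lhs => rw [Matrix.matrix_eq_sum_single X]
    simp only [map_sum]
    refine Finset.sum_congr rfl fun a _ => Finset.sum_congr rfl fun b _ => ?_
    rw [← smul_eq_mul, ← map_smul, Matrix.smul_single, smul_eq_mul, mul_one]
  have hint : ∀ a b, Integrable (fun ω => x ω a * x ω b * f (Matrix.single a b 1)) μ :=
    fun a b => ((hx.eval a).integrable_mul (hx.eval b)).mul_const _
  rw [hf]
  simp only [hf (Matrix.vecMulVec _ _), Matrix.vecMulVec_apply]
  rw [integral_finsetSum _ fun a _ => integrable_finsetSum _ fun b _ => hint a b]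
  refine Finset.sum_congr rfl fun a _ => ?_
  rw [integral_finsetSum _ fun b _ => hint a b]
  refine Finset.sum_congr rfl fun b _ => ?_
  rw [integral_mul_const, covMat_apply_of_integral_eq_zero hx hmean]

end SecondMoment

/-- The Lyapunov series as a linear map in its source term. -/
def lyapLinear {ι : Type*} [Fintype ι] [DecidableEq ι] {A : Matrix ι ι ℝ} (hA : PowDecay A) :
    Matrix ι ι ℝ →ₗ[ℝ] Matrix ι ι ℝ where
  toFun := lyapSum A
  map_add' := hA.lyapSum_add
  map_smul' := lyapSum_smul

namespace LQRTask

variable {dx du : ℕ} (T : LQRTask dx du) {K : Matrix (Fin du) (Fin dx) ℝ}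

lemma powDecay_closedLoop {T : LQRTask dx du} (hK : K ∈ T.stabilizing) :
    PowDecay (T.closedLoop K) :=
  IsSchurStable.powDecay hK

lemma traj_eq_pow_mulVec (x : Fin dx → ℝ) (t : ℕ) :
    T.traj K x t = T.closedLoop K ^ t *ᵥ x := by
  induction t with
  | zero => simp [traj]
  | succ t ih =>
    rw [traj, pow_succ', ← Matrix.mulVec_mulVec, ← ih, closedLoop, Matrix.sub_mulVec,
      Matrix.mulVec_neg, ← Matrix.mulVec_mulVec, sub_eq_add_neg]

lemma vecMulVec_traj (x : Fin dx → ℝ) (t : ℕ) :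
    Matrix.vecMulVec (T.traj K x t) (T.traj K x t) =
      T.closedLoop K ^ t * Matrix.vecMulVec x x * (T.closedLoop K ^ t)ᵀ := by
  rw [traj_eq_pow_mulVec, Matrix.mul_vecMulVec, Matrix.vecMulVec_mul, Matrix.vecMul_transpose]

variable {Ω : Type*} [MeasurableSpace Ω] {μ : Measure Ω} [IsProbabilityMeasure μ]
  {x₀ : Ω → Fin dx → ℝ}

lemma stateCov_eq_lyapSum (hx : MemLp x₀ 2 μ) (hmean : ∫ ω, x₀ ω ∂μ = 0)
    (hK : K ∈ T.stabilizing) :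
    T.stateCov μ x₀ K = lyapSum (T.closedLoop K) (covMat μ x₀) := by
  ext a b
  have h := integral_linear_vecMulVec_self hx hmean
    ((Matrix.entryLinearMap ℝ ℝ a b).comp (lyapLinear (powDecay_closedLoop hK)))
  refine Eq.trans ?_ h
  rw [stateCov, Matrix.of_apply]
  refine integral_congr_ae (.of_forall fun ω => tsum_congr fun t => ?_)
  simp only [← vecMulVec_traj]
  rfl

lemma tsum_stage_eq_trace (hK : K ∈ T.stabilizing) (x : Fin dx → ℝ) :
    ∑' t : ℕ, T.traj K x t ⬝ᵥ (T.stageCost K *ᵥ T.traj K x t) =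
      (T.stageCost K * lyapSum (T.closedLoop K) (Matrix.vecMulVec x x)).trace := by
  have h := (powDecay_closedLoop hK).hasSum_conj (Matrix.vecMulVec x x)
  have h2 := h.map ((Matrix.traceAddMonoidHom (Fin dx) ℝ).comp
    (AddMonoidHom.mulLeft (T.stageCost K)))
    (by
      change Continuous fun Y : Matrix (Fin dx) (Fin dx) ℝ => (T.stageCost K * Y).trace
      fun_prop)
  refine Eq.trans (tsum_congr fun t => ?_) h2.tsum_eq
  change _ = (T.stageCost K * (T.closedLoop K ^ t * Matrix.vecMulVec x x *
    (T.closedLoop K ^ t)ᵀ)).trace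
  rw [← vecMulVec_traj, Matrix.mul_vecMulVec, Matrix.trace_vecMulVec, dotProduct_comm]

lemma cost_eq_trace (hx : MemLp x₀ 2 μ) (hmean : ∫ ω, x₀ ω ∂μ = 0) (hK : K ∈ T.stabilizing) :
    T.cost μ x₀ K =
      (T.stageCost K * lyapSum (T.closedLoop K) (covMat μ x₀)).trace := by
  have h := integral_linear_vecMulVec_self hx hmean
    ((Matrix.traceLinearMap (Fin dx) ℝ ℝ).comp
      ((LinearMap.mulLeft ℝ (T.stageCost K)).comp (lyapLinear (powDecay_closedLoop hK))))
  refine Eq.trans ?_ h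
  refine integral_congr_ae (.of_forall fun ω => ?_)
  exact T.tsum_stage_eq_trace hK (x₀ ω)

lemma posSemidef_stageCost (K : Matrix (Fin du) (Fin dx) ℝ) : (T.stageCost K).PosSemidef := by
  have h := T.posDef_R.posSemidef.conjTranspose_mul_mul_same K
  rw [Matrix.conjTranspose_eq_transpose_of_trivial] at h
  exact T.posSemidef_Q.add h

lemma lyapunovSol_eq_lyapSum (hK : K ∈ T.stabilizing) :
    T.lyapunovSol K = lyapSum (T.closedLoop K)ᵀ (T.stageCost K) := by
  have hA := (powDecay_closedLoop hK).transpose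
  have hex : ∃ P, P - (T.closedLoop K)ᵀ * P * T.closedLoop K = T.stageCost K :=
    ⟨_, sub_eq_of_eq_add (by simpa using hA.lyapSum_eq (T.stageCost K))⟩
  refine hA.eq_lyapSum ?_
  have h : T.lyapunovSol K - (T.closedLoop K)ᵀ * T.lyapunovSol K * T.closedLoop K =
    T.stageCost K := Classical.epsilon_spec hex
  rw [Matrix.transpose_transpose, ← h, sub_add_cancel]

lemma lyapunovSol_sub (hK : K ∈ T.stabilizing) :
    T.lyapunovSol K - (T.closedLoop K)ᵀ * T.lyapunovSol K * T.closedLoop K = T.stageCost K := by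
  rw [lyapunovSol_eq_lyapSum T hK]
  refine sub_eq_of_eq_add ?_
  simpa using (powDecay_closedLoop hK).transpose.lyapSum_eq (T.stageCost K)

lemma posSemidef_lyapunovSol (hK : K ∈ T.stabilizing) : (T.lyapunovSol K).PosSemidef := by
  rw [lyapunovSol_eq_lyapSum T hK]
  exact (powDecay_closedLoop hK).transpose.posSemidef_lyapSum (T.posSemidef_stageCost K)

/-- The cost difference formula: writing `Δ = K' - K` and `G = R + Bᵀ P_K B`, the cost changes by
`tr((Δᵀ E_K + Δᵀ G Δ) Σ_{K'})`. It yields both the gradient of the cost and gradient domination. -/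
lemma trace_cost_sub {K' : Matrix (Fin du) (Fin dx) ℝ} {S : Matrix (Fin dx) (Fin dx) ℝ}
    (hS : S.PosSemidef) (hK : K ∈ T.stabilizing) (hK' : K' ∈ T.stabilizing) :
    (T.stageCost K' * lyapSum (T.closedLoop K') S).trace -
        (T.stageCost K * lyapSum (T.closedLoop K) S).trace =
      (((K' - K)ᵀ * T.gradFactor K +
        (K' - K)ᵀ * (T.R + T.Bᵀ * T.lyapunovSol K * T.B) * (K' - K)) *
          lyapSum (T.closedLoop K') S).trace := by
  have hA := powDecay_closedLoop hK
  have hA' := powDecay_closedLoop hK'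
  set P := T.lyapunovSol K with hP
  set W := lyapSum (T.closedLoop K') S with hW
  have hPt : Pᵀ = P := (T.posSemidef_lyapunovSol hK).isHermitian
  have hRt : T.Rᵀ = T.R := T.posDef_R.isHermitian
  have hWt : Wᵀ = W := (hA'.posSemidef_lyapSum hS).isHermitian
  have h1 : (T.stageCost K * lyapSum (T.closedLoop K) S).trace = (P * S).trace := by
    rw [← T.lyapunovSol_sub hK, hA.trace_mul_lyapSum]
  rw [h1, ← hA'.trace_mul_lyapSum P S, ← Matrix.trace_sub, ← sub_mul]
  set Δ := K' - K with hΔ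
  set H := (T.R + T.Bᵀ * P * T.B) * K - T.Bᵀ * P * T.A with hH
  have hgrad : T.gradFactor K = (2 : ℝ) • H := rfl
  have hsym : (Hᵀ * Δ * W).trace = (Δᵀ * H * W).trace := by
    rw [← Matrix.trace_transpose]
    simp only [Matrix.transpose_mul, Matrix.transpose_transpose, hWt]
    rw [Matrix.trace_mul_comm]
  have key : T.stageCost K' - (P - (T.closedLoop K')ᵀ * P * T.closedLoop K') =
      Δᵀ * H + Hᵀ * Δ + Δᵀ * (T.R + T.Bᵀ * P * T.B) * Δ := by
    have hQ : T.Q = P - (T.closedLoop K)ᵀ * P * T.closedLoop K - Kᵀ * T.R * K := by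
      rw [T.lyapunovSol_sub hK, stageCost, add_sub_cancel_right]
    have hK'eq : K' = K + Δ := by rw [hΔ]; abel
    rw [stageCost, hQ, hK'eq, hH]
    simp only [closedLoop, Matrix.transpose_sub, Matrix.transpose_add, Matrix.transpose_mul,
      Matrix.transpose_transpose, hPt, hRt, mul_add, add_mul, mul_sub, sub_mul,
      Matrix.mul_add, Matrix.add_mul, Matrix.mul_sub, Matrix.sub_mul, Matrix.mul_assoc]
    abel
  rw [key, hgrad]
  simp only [add_mul, Matrix.trace_add, hsym, Matrix.mul_smul, Matrix.smul_mul,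
    Matrix.trace_smul, smul_eq_mul]
  ring

end LQRTask

/-! ### Eigenvalue, singular value and trace inequalities -/

section Spectral

variable {ι : Type} [Fintype ι] [DecidableEq ι]

/-- The Rayleigh quotient bound for `lambdaMin`. -/
lemma lambdaMin_mul_dotProduct_le {M : Matrix ι ι ℝ} (hM : M.IsHermitian) (v : ι → ℝ) :
    lambdaMin M * (v ⬝ᵥ v) ≤ v ⬝ᵥ (M *ᵥ v) := by
  have hbdd : BddBelow (spectrum ℝ M) := (Matrix.finite_real_spectrum).bddBelow
  have h : (M - lambdaMin M • (1 : Matrix ι ι ℝ)).PosSemidef := by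
    rw [Matrix.posSemidef_iff_isHermitian_and_spectrum_nonneg]
    refine ⟨hM.sub (by simp [Matrix.IsHermitian]), fun x hx => ?_⟩
    rw [← Algebra.algebraMap_eq_smul_one, ← spectrum.sub_singleton_eq] at hx
    obtain ⟨y, hy, z, rfl, rfl⟩ := hx
    exact sub_nonneg.2 (csInf_le hbdd hy)
  have h2 := h.dotProduct_mulVec_nonneg v
  simp only [Matrix.sub_mulVec, Matrix.smul_mulVec, Matrix.one_mulVec, dotProduct_sub,
    dotProduct_smul, star_trivial, smul_eq_mul] at h2
  linarith

lemma lambdaMin_mem_spectrum [Nonempty ι] {M : Matrix ι ι ℝ} (hM : M.IsHermitian) :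
    lambdaMin M ∈ spectrum ℝ M := by
  refine Set.Nonempty.csInf_mem ?_ Matrix.finite_real_spectrum
  rw [hM.spectrum_real_eq_range_eigenvalues]
  exact Set.range_nonempty _

lemma lambdaMin_pos [Nonempty ι] {M : Matrix ι ι ℝ} (hM : M.PosDef) : 0 < lambdaMin M := by
  have h := lambdaMin_mem_spectrum hM.isHermitian
  rw [hM.isHermitian.spectrum_real_eq_range_eigenvalues] at h
  obtain ⟨j, hj⟩ := h
  rw [← hj]
  exact hM.eigenvalues_pos j

lemma sigmaMin_pos {n : ℕ} (hn : 0 < n) {R : Matrix (Fin n) (Fin n) ℝ} (hR : R.PosDef) :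
    0 < sigmaMin R := by
  have hinj : Function.Injective (Matrix.toEuclideanLin R) := by
    intro x y hxy
    have h : R *ᵥ x.ofLp = R *ᵥ y.ofLp := congrArg WithLp.ofLp hxy
    exact (WithLp.ofLp_injective 2) (Matrix.mulVec_injective_of_isUnit hR.isUnit h)
  exact (LinearMap.injective_iff_forall_lt_finrank_singularValues_pos _).1 hinj _
    (by simpa using hn)

/-- For positive definite `R` the smallest singular value bounds the quadratic form from below:
the square of each eigenvalue of `R` is an eigenvalue of `Rᵀ R`. -/
lemma sigmaMin_mul_dotProduct_le {n : ℕ} {R : Matrix (Fin n) (Fin n) ℝ} (hR : R.PosDef)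
    (v : Fin n → ℝ) : sigmaMin R * (v ⬝ᵥ v) ≤ v ⬝ᵥ (R *ᵥ v) := by
  rcases Nat.eq_zero_or_pos n with rfl | hn
  · simp [dotProduct]
  have : Nonempty (Fin n) := ⟨⟨0, hn⟩⟩
  refine le_trans (mul_le_mul_of_nonneg_right ?_ (dotProduct_self_star_nonneg v))
    (lambdaMin_mul_dotProduct_le hR.isHermitian v)
  have hmem := lambdaMin_mem_spectrum hR.isHermitian
  set lm := lambdaMin R with hlm
  have hpos : 0 < lm := lambdaMin_pos hR
  set L := Matrix.toEuclideanLin R with hL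
  have hsym : L.IsSymmetric := Matrix.isSymmetric_toEuclideanLin_iff.2 hR.isHermitian
  rw [← Matrix.spectrum_toLpLin 2, ← Module.End.hasEigenvalue_iff_mem_spectrum] at hmem
  obtain ⟨w, hw⟩ := hmem.exists_hasEigenvector
  have hadj : L.adjoint = L := LinearMap.isSymmetric_iff_isSelfAdjoint _ |>.1 hsym
  have hev : Module.End.HasEigenvalue (L.adjoint ∘ₗ L) (lm ^ 2) := by
    refine Module.End.hasEigenvalue_of_hasEigenvector (x := w)
      ⟨Module.End.mem_eigenspace_iff.2 ?_, hw.2⟩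
    rw [hadj, LinearMap.comp_apply, hw.apply_eq_smul, map_smul, hw.apply_eq_smul, smul_smul, sq]
  have hfin : Module.finrank ℝ (EuclideanSpace ℝ (Fin n)) = n := by simp
  obtain ⟨k, hk⟩ := L.isSymmetric_adjoint_comp_self.exists_eigenvalues_eq hfin hev
  have h1 : sigmaMin R ^ 2 ≤ lm ^ 2 := by
    have h2 := L.sq_singularValues_of_lt hfin (i := n - 1) (by omega)
    rw [sigmaMin, h2]
    have hk' : L.isSymmetric_adjoint_comp_self.eigenvalues hfin k = lm ^ 2 := by simpa using hk
    rw [← hk']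
    refine L.isSymmetric_adjoint_comp_self.eigenvalues_antitone hfin ?_
    rw [Fin.le_def]
    simp only
    omega
  exact le_of_sq_le_sq h1 hpos.le

lemma dotProduct_mulVec_le_spectralNorm2 {n : ℕ} (M : Matrix (Fin n) (Fin n) ℝ) (v : Fin n → ℝ) :
    v ⬝ᵥ (M *ᵥ v) ≤ spectralNorm2 M * (v ⬝ᵥ v) := by
  set w : EuclideanSpace ℝ (Fin n) := WithLp.toLp 2 v
  have h1 : v ⬝ᵥ (M *ᵥ v) = inner ℝ (Matrix.toEuclideanCLM (n := Fin n) (𝕜 := ℝ) M w) w := by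
    simp [w, EuclideanSpace.inner_eq_star_dotProduct]
  have h2 : v ⬝ᵥ v = ‖w‖ ^ 2 := by
    simp [w, EuclideanSpace.norm_sq_eq, dotProduct, ← sq]
  rw [h1, h2, spectralNorm2]
  refine (real_inner_le_norm _ _).trans ?_
  have := (Matrix.toEuclideanCLM (n := Fin n) (𝕜 := ℝ) M).le_opNorm w
  nlinarith [norm_nonneg w]

end Spectral

section Trace

variable {ι κ : Type*} [Fintype ι] [Fintype κ]

lemma trace_mul_mul_transpose (X : Matrix ι ι ℝ) (L : Matrix κ ι ℝ) :
    (L * X * Lᵀ).trace = ∑ k, L k ⬝ᵥ (X *ᵥ L k) := by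
  simp only [Matrix.trace, Matrix.diag_apply, Matrix.mul_apply, Matrix.transpose_apply,
    dotProduct, Matrix.mulVec, Finset.sum_mul, Finset.mul_sum]
  refine Finset.sum_congr rfl fun k _ => ?_
  rw [Finset.sum_comm]
  exact Finset.sum_congr rfl fun a _ => Finset.sum_congr rfl fun b _ => by ring

/-- Every positive semidefinite real matrix is a Gram matrix. -/
lemma Matrix.PosSemidef.exists_eq_transpose_mul_self {W : Matrix ι ι ℝ} (hW : W.PosSemidef) :
    ∃ (m : ℕ) (L : Matrix (Fin m) ι ℝ), W = Lᵀ * L := by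
  obtain ⟨m, v, hv⟩ := Matrix.posSemidef_iff_eq_sum_vecMulVec.1 hW
  refine ⟨m, Matrix.of v, ?_⟩
  ext a b
  simp [hv, Matrix.sum_apply, Matrix.vecMulVec_apply, Matrix.mul_apply]

lemma trace_mul_transpose_mul_self (X : Matrix ι ι ℝ) (L : Matrix κ ι ℝ) :
    (X * (Lᵀ * L)).trace = ∑ k, L k ⬝ᵥ (X *ᵥ L k) := by
  rw [← trace_mul_mul_transpose, ← Matrix.mul_assoc, Matrix.trace_mul_comm, Matrix.mul_assoc]

lemma trace_mul_nonneg {X W : Matrix ι ι ℝ} (hX : ∀ v, 0 ≤ v ⬝ᵥ (X *ᵥ v)) (hW : W.PosSemidef) :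
    0 ≤ (X * W).trace := by
  obtain ⟨m, L, rfl⟩ := hW.exists_eq_transpose_mul_self
  rw [trace_mul_transpose_mul_self]
  exact Finset.sum_nonneg fun k _ => hX _

end Trace

/-! ### The Frobenius norm -/

section Frobenius

attribute [local instance] Matrix.frobeniusNormedAddCommGroup Matrix.frobeniusNormedSpace

variable {ι κ : Type*} [Fintype ι] [Fintype κ]

lemma frobenius_norm_sq (X : Matrix κ ι ℝ) : ‖X‖ ^ 2 = ∑ a, X a ⬝ᵥ X a := by
  rw [Matrix.frobenius_norm_def, ← Real.sqrt_eq_rpow, Real.sq_sqrt (by positivity)]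
  simp [dotProduct, sq]

lemma frobenius_norm_vecMulVec_sq (v : κ → ℝ) (w : ι → ℝ) :
    ‖Matrix.vecMulVec v w‖ ^ 2 = (v ⬝ᵥ v) * (w ⬝ᵥ w) := by
  rw [frobenius_norm_sq]
  simp only [dotProduct, Matrix.vecMulVec_apply, Finset.sum_mul_sum]
  exact Finset.sum_congr rfl fun a _ => Finset.sum_congr rfl fun b _ => by ring

lemma frobenius_norm_add_le_sqrt_two_mul (Y Z : Matrix κ ι ℝ) :
    ‖Y + Z‖ ≤ √2 * ‖Matrix.fromCols Y Z‖ := by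
  have h : ‖Matrix.fromCols Y Z‖ ^ 2 = ‖Y‖ ^ 2 + ‖Z‖ ^ 2 := by
    simp only [frobenius_norm_sq, ← Finset.sum_add_distrib]
    refine Finset.sum_congr rfl fun a _ => ?_
    simp [dotProduct, Fintype.sum_sum_type]
  have h2 : ‖Y + Z‖ ≤ ‖Y‖ + ‖Z‖ := norm_add_le _ _
  refine h2.trans (le_of_sq_le_sq ?_ (by positivity))
  rw [mul_pow, Real.sq_sqrt (by norm_num), h]
  nlinarith [sq_nonneg (‖Y‖ - ‖Z‖)]

/-- If `Eᵀ E ⪯ M`, then `‖E W‖_F ≤ tr(M W) / √λ_min(M)` for positive semidefinite `W`: write `W` as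
a sum of rank-one matrices `w wᵀ` and use
`‖E w‖ ‖w‖ ≤ √(wᵀ M w) √(wᵀ M w / λ_min(M))` on each. -/
lemma frobenius_norm_mul_le {ι : Type} [Fintype ι] [DecidableEq ι] [Nonempty ι]
    {M W : Matrix ι ι ℝ} {E : Matrix κ ι ℝ} (hM : M.PosDef)
    (hE : (M - Eᵀ * E).PosSemidef) (hW : W.PosSemidef) :
    ‖E * W‖ ≤ (M * W).trace / √(lambdaMin M) := by
  obtain ⟨m, L, rfl⟩ := hW.exists_eq_transpose_mul_self
  have hlm := lambdaMin_pos hM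
  have hdec : E * (Lᵀ * L) = ∑ k, Matrix.vecMulVec (E *ᵥ L k) (L k) := by
    rw [← Matrix.mul_assoc]
    ext a b
    simp only [Matrix.sum_apply, Matrix.vecMulVec_apply, Matrix.mul_apply,
      Matrix.mulVec, dotProduct, Matrix.transpose_apply]
  rw [hdec, trace_mul_transpose_mul_self, Finset.sum_div]
  refine (norm_sum_le _ _).trans (Finset.sum_le_sum fun k _ => ?_)
  have h1 := hE.dotProduct_mulVec_nonneg (L k)
  have h2 := lambdaMin_mul_dotProduct_le hM.isHermitian (L k)
  have h3 := hM.posSemidef.dotProduct_mulVec_nonneg (L k)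
  have h4 : L k ⬝ᵥ ((Eᵀ * E) *ᵥ L k) = (E *ᵥ L k) ⬝ᵥ (E *ᵥ L k) := by
    rw [← Matrix.mulVec_mulVec, Matrix.dotProduct_mulVec, Matrix.vecMul_transpose]
  simp only [Matrix.sub_mulVec, dotProduct_sub, star_trivial, h4, sub_nonneg] at h1 h3
  refine le_of_sq_le_sq ?_ (by positivity)
  rw [frobenius_norm_vecMulVec_sq, div_pow, Real.sq_sqrt hlm.le, le_div_iff₀ hlm]
  have h5 : 0 ≤ (E *ᵥ L k) ⬝ᵥ (E *ᵥ L k) := dotProduct_self_star_nonneg _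
  have h6 : 0 ≤ L k ⬝ᵥ L k := dotProduct_self_star_nonneg _
  nlinarith [mul_le_mul h1 h2 (by positivity) h3]

end Frobenius

/-! ### Feasibility of the bisimulation inequalities -/

section Feasible

lemma exists_smul_one_sub_posSemidef {ι : Type} [Fintype ι] [DecidableEq ι] {X : Matrix ι ι ℝ}
    (hX : X.IsHermitian) : ∃ c : ℝ, 1 ≤ c ∧ (c • (1 : Matrix ι ι ℝ) - X).PosSemidef := by
  refine ⟨max 1 (-lambdaMin (-X)), le_max_left _ _, ?_⟩
  refine Matrix.PosSemidef.of_dotProduct_mulVec_nonneg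
    (Matrix.IsHermitian.sub (by simp [Matrix.IsHermitian]) hX) fun v => ?_
  have h1 := lambdaMin_mul_dotProduct_le hX.neg v
  have h2 : -lambdaMin (-X) * (v ⬝ᵥ v) ≤ max 1 (-lambdaMin (-X)) * (v ⬝ᵥ v) :=
    mul_le_mul_of_nonneg_right (le_max_right _ _) (dotProduct_self_star_nonneg v)
  simp only [Matrix.sub_mulVec, Matrix.smul_mulVec, Matrix.one_mulVec, dotProduct_sub,
    dotProduct_smul, star_trivial, smul_eq_mul, Matrix.neg_mulVec, dotProduct_neg] at h1 h2 ⊢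
  linarith

variable {dx du : ℕ} {T T' : LQRTask dx du} {K : Matrix (Fin du) (Fin dx) ℝ}

/-- The infimum defining `bisimHet` is over a nonempty set when `K` stabilizes both tasks: a large
multiple of the Lyapunov matrix `∑ₜ (Aᵗ)ᵀ Aᵗ` of the pair satisfies both matrix inequalities. -/
lemma exists_bisimFeasible (hK : K ∈ T.stabilizing) (hK' : K ∈ T'.stabilizing) :
    ∃ M lam, BisimFeasible T T' K M lam := by
  have hA : PowDecay (pairClosedLoop T T' K) :=
    (LQRTask.powDecay_closedLoop hK).fromBlocks (LQRTask.powDecay_closedLoop hK')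
  set A := pairClosedLoop T T' K
  set E := pairGradFactor T T' K
  set M₀ := lyapSum Aᵀ 1 with hM₀
  have hone : (1 : Matrix (Fin dx ⊕ Fin dx) (Fin dx ⊕ Fin dx) ℝ).PosSemidef := .one
  have hsub : (M₀ - 1).PosSemidef := hA.transpose.posSemidef_lyapSum_sub hone
  have hpos : M₀.PosDef := by
    have := Matrix.PosDef.one.add_posSemidef hsub
    rwa [add_sub_cancel] at this
  have heq : Aᵀ * M₀ * A = M₀ - 1 := by
    have := hA.transpose.lyapSum_eq 1
    rw [Matrix.transpose_transpose] at this
    rw [eq_sub_iff_add_eq', ← this]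
  have hEE : (Eᵀ * E).PosSemidef := by
    simpa [Matrix.conjTranspose_eq_transpose_of_trivial] using
      Matrix.posSemidef_conjTranspose_mul_self E
  obtain ⟨c, hc, hcE⟩ := exists_smul_one_sub_posSemidef hEE.isHermitian
  obtain ⟨d, hd, hdM⟩ := exists_smul_one_sub_posSemidef hpos.isHermitian
  have hc0 : 0 < c := by linarith
  have hd0 : 0 < d := by linarith
  -- `Eᵀ E ⪯ c I ⪯ c M₀`, and `M₀ ⪯ d I` gives `λ M₀ ⪯ I = M₀ - Aᵀ M₀ A` for `λ ≤ 1 / d`;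
  -- the factor `2` keeps `λ` strictly below `1`
  refine ⟨c • M₀, (2 * d)⁻¹, hpos.smul hc0, by positivity, inv_lt_one_of_one_lt₀ (by linarith),
    ?_, ?_⟩
  · have h := hcE.add (hsub.smul hc0.le)
    rwa [smul_sub, sub_add_sub_comm, add_comm (c • (1 : Matrix _ _ ℝ)), add_sub_add_right_eq_sub]
      at h
  · have h : (((2 * d)⁻¹ * c) • ((d • (1 : Matrix _ _ ℝ) - M₀) + d • 1)).PosSemidef :=
      (hdM.add (hone.smul hd0.le)).smul (by positivity)
    convert h using 1
    rw [Matrix.mul_smul, Matrix.smul_mul, heq]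
    match_scalars <;> field_simp <;> ring

end Feasible

/-! ### Stationarity of the average cost -/

lemma tendsto_trace_smul_sub_mul {ι : Type*} [Fintype ι] (Q E : Matrix ι ι ℝ)
    {W : ℝ → Matrix ι ι ℝ} {W₀ : Matrix ι ι ℝ} {u : Set ℝ}
    (hW : Filter.Tendsto W (nhdsWithin 0 u) (nhds W₀)) :
    Filter.Tendsto (fun s : ℝ => ((s • Q - E) * W s).trace) (nhdsWithin 0 u)
      (nhds (-E * W₀).trace) := by
  have hs : Filter.Tendsto (fun s : ℝ => s • Q - E) (nhdsWithin 0 u) (nhds (-E)) := by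
    have hc : Continuous fun s : ℝ => s • Q - E := by fun_prop
    simpa using (hc.tendsto 0).mono_left (nhdsWithin_le_nhds (s := u))
  have hc : Continuous fun X : Matrix ι ι ℝ => X.trace := by fun_prop
  exact (hc.tendsto _).comp (hs.mul hW)

/-- The gradient of the average cost vanishes at a minimizer. Moving along the negative gradient
keeps `K` stabilizing for small steps, the cost difference formula gives the increment, and
continuity of the Lyapunov solution identifies its first-order term. -/
lemma sum_gradFactor_mul_lyapSum_eq_zero {N dx du : ℕ} {T : Fin N → LQRTask dx du}
    {K : Matrix (Fin du) (Fin dx) ℝ} (hK : K ∈ commonStabilizing T)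
    {S : Fin N → Matrix (Fin dx) (Fin dx) ℝ} (hS : ∀ i, (S i).PosSemidef)
    (hmin : IsMinOn (fun K' => ∑ i, ((T i).stageCost K' * lyapSum ((T i).closedLoop K') (S i)).trace)
      (commonStabilizing T) K) :
    ∑ i, (T i).gradFactor K * lyapSum ((T i).closedLoop K) (S i) = 0 := by
  have hKi : ∀ i, K ∈ (T i).stabilizing := Set.mem_iInter.1 hK
  set G := ∑ i, (T i).gradFactor K * lyapSum ((T i).closedLoop K) (S i) with hG
  have hcl : ∀ i, Continuous fun s : ℝ => (T i).closedLoop (K - s • G) := fun i => by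
    unfold LQRTask.closedLoop
    fun_prop
  have hcl0 : ∀ i, Filter.Tendsto (fun s : ℝ => (T i).closedLoop (K - s • G))
      (nhdsWithin 0 (Set.Ioi 0)) (nhds ((T i).closedLoop K)) := fun i => by
    have := ((hcl i).tendsto 0).mono_left (nhdsWithin_le_nhds (s := Set.Ioi 0))
    simpa using this
  have hstab : ∀ i, ∀ᶠ s : ℝ in nhdsWithin 0 (Set.Ioi 0), K - s • G ∈ (T i).stabilizing :=
    fun i => (hcl0 i).eventually (isOpen_setOf_isSchurStable.mem_nhds (hKi i))
  have hW : ∀ i, Filter.Tendsto (fun s : ℝ => lyapSum ((T i).closedLoop (K - s • G)) (S i))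
      (nhdsWithin 0 (Set.Ioi 0)) (nhds (lyapSum ((T i).closedLoop K) (S i))) := fun i =>
    tendsto_lyapSum (LQRTask.powDecay_closedLoop (hKi i))
      ((hstab i).mono fun s hs => LQRTask.powDecay_closedLoop hs) (hcl0 i) (S i)
  -- the second-order coefficient of the cost along the direction `-G`
  obtain ⟨Q, hQ⟩ : ∃ Q : Fin N → Matrix (Fin dx) (Fin dx) ℝ, ∀ i,
    Q i = Gᵀ * ((T i).R + (T i).Bᵀ * (T i).lyapunovSol K * (T i).B) * G := ⟨_, fun _ => rfl⟩
  have hlim : Filter.Tendsto (fun s : ℝ => ∑ i, ((s • Q i - Gᵀ * (T i).gradFactor K) *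
      lyapSum ((T i).closedLoop (K - s • G)) (S i)).trace)
      (nhdsWithin 0 (Set.Ioi 0)) (nhds (-(Gᵀ * G).trace)) := by
    have hval : -(Gᵀ * G).trace = ∑ i, ((-(Gᵀ * (T i).gradFactor K)) *
          lyapSum ((T i).closedLoop K) (S i)).trace := by
      simp only [Matrix.neg_mul, Matrix.trace_neg, Matrix.mul_assoc Gᵀ,
        Finset.sum_neg_distrib, ← Matrix.trace_sum, ← Matrix.mul_sum]
      rw [← hG]
    rw [hval]
    exact tendsto_finsetSum _ fun i _ => tendsto_trace_smul_sub_mul (Q i) _ (hW i)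
  have hnonneg : ∀ᶠ s : ℝ in nhdsWithin 0 (Set.Ioi 0),
      0 ≤ ∑ i, ((s • Q i - Gᵀ * (T i).gradFactor K) *
        lyapSum ((T i).closedLoop (K - s • G)) (S i)).trace := by
    filter_upwards [Filter.eventually_all.2 hstab, self_mem_nhdsWithin] with s hs hs0
    have hle := isMinOn_iff.1 hmin (K - s • G) (Set.mem_iInter.2 hs)
    rw [← sub_nonneg, ← Finset.sum_sub_distrib] at hle
    refine nonneg_of_mul_nonneg_right (a := s) ?_ hs0
    refine hle.trans_eq ?_
    rw [Finset.mul_sum]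
    refine Finset.sum_congr rfl fun i _ => ?_
    rw [(T i).trace_cost_sub (hS i) (hKi i) (hs i), ← smul_eq_mul s, ← Matrix.trace_smul,
      ← Matrix.smul_mul, sub_sub_cancel_left, hQ]
    congr 2
    simp only [Matrix.transpose_neg, Matrix.transpose_smul, Matrix.neg_mul, Matrix.smul_mul,
      Matrix.mul_neg, Matrix.mul_smul, neg_neg, smul_sub, smul_neg]
    abel
  have h0 := ge_of_tendsto hlim hnonneg
  have h1 := (Matrix.posSemidef_conjTranspose_mul_self G).trace_nonneg
  rw [Matrix.conjTranspose_eq_transpose_of_trivial] at h1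
  refine Matrix.trace_conjTranspose_mul_self_eq_zero_iff.1 ?_
  rw [Matrix.conjTranspose_eq_transpose_of_trivial]
  linarith

/-! ### Gradient heterogeneity and gradient domination -/

section Gradient

attribute [local instance] Matrix.frobeniusNormedAddCommGroup Matrix.frobeniusNormedSpace

variable {dx du : ℕ}

/-- Each feasible pair bounds the Frobenius distance of the two policy gradients `E_K Σ_K`:
with `W = diag(Σ_K, Σ'_K)` the difference is `E W [I; I]`, and the second matrix inequality gives
`λ tr(M W) ≤ tr(M diag(S, S'))`. -/
lemma BisimFeasible.norm_sub_le [NeZero dx] {T T' : LQRTask dx du}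
    {K : Matrix (Fin du) (Fin dx) ℝ}
    {M : Matrix (Fin dx ⊕ Fin dx) (Fin dx ⊕ Fin dx) ℝ} {lam : ℝ} (h : BisimFeasible T T' K M lam)
    (hK : K ∈ T.stabilizing) (hK' : K ∈ T'.stabilizing) {S S' : Matrix (Fin dx) (Fin dx) ℝ}
    (hS : S.PosSemidef) (hS' : S'.PosSemidef) :
    ‖T.gradFactor K * lyapSum (T.closedLoop K) S -
        T'.gradFactor K * lyapSum (T'.closedLoop K) S'‖ ≤ bisimBound S S' M lam := by
  obtain ⟨hM, hl0, -, hE, hlmi⟩ := h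
  have hA := LQRTask.powDecay_closedLoop hK
  have hA' := LQRTask.powDecay_closedLoop hK'
  have hAA : PowDecay (pairClosedLoop T T' K) := hA.fromBlocks hA'
  have hSS : (Matrix.fromBlocks S 0 0 S').PosSemidef := by
    refine Matrix.PosSemidef.of_dotProduct_mulVec_nonneg
      (Matrix.IsHermitian.fromBlocks hS.isHermitian (by simp) hS'.isHermitian) fun v => ?_
    have h1 := hS.dotProduct_mulVec_nonneg (v ∘ Sum.inl)
    have h2 := hS'.dotProduct_mulVec_nonneg (v ∘ Sum.inr)
    simp only [star_trivial] at h1 h2 ⊢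
    rw [Matrix.fromBlocks_mulVec, ← Sum.elim_comp_inl_inr v, sumElim_dotProduct_sumElim]
    simpa using add_nonneg h1 h2
  have hWeq : lyapSum (pairClosedLoop T T' K) (Matrix.fromBlocks S 0 0 S') =
      Matrix.fromBlocks (lyapSum (T.closedLoop K) S) 0 0 (lyapSum (T'.closedLoop K) S') := by
    refine (hAA.eq_lyapSum ?_).symm
    rw [pairClosedLoop, Matrix.fromBlocks_transpose, Matrix.fromBlocks_multiply,
      Matrix.fromBlocks_multiply, Matrix.fromBlocks_add]
    simp [← hA.lyapSum_eq S, ← hA'.lyapSum_eq S']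
  have hW := hAA.posSemidef_lyapSum hSS
  set A := pairClosedLoop T T' K with hAdef
  set E := pairGradFactor T T' K with hEdef
  set W := lyapSum A (Matrix.fromBlocks S 0 0 S') with hWdef
  have hEW : E * W = Matrix.fromCols (T.gradFactor K * lyapSum (T.closedLoop K) S)
      (-(T'.gradFactor K * lyapSum (T'.closedLoop K) S')) := by
    rw [hWeq, hEdef, pairGradFactor, Matrix.fromCols_mul_fromBlocks]
    simp
  have htr : lam * (M * W).trace ≤ (M * Matrix.fromBlocks S 0 0 S').trace := by
    rw [← hAA.trace_mul_lyapSum M (Matrix.fromBlocks S 0 0 S'), ← hWdef]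
    have h1 := trace_mul_nonneg (fun v => by simpa using hlmi.dotProduct_mulVec_nonneg v) hW
    have h2 : (-(lam • M) - (Aᵀ * M * A - M)) * W = (M - Aᵀ * M * A) * W - lam • (M * W) := by
      rw [← Matrix.smul_mul, ← Matrix.sub_mul]
      congr 1
      abel
    rw [h2, Matrix.trace_sub, Matrix.trace_smul, smul_eq_mul] at h1
    exact sub_nonneg.1 h1
  have hlm := lambdaMin_pos hM
  calc ‖T.gradFactor K * lyapSum (T.closedLoop K) S -
        T'.gradFactor K * lyapSum (T'.closedLoop K) S'‖ ≤ √2 * ‖E * W‖ := by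
        rw [hEW, sub_eq_add_neg]
        exact frobenius_norm_add_le_sqrt_two_mul _ _
    _ ≤ √2 * ((M * W).trace / √(lambdaMin M)) := by
        gcongr
        exact frobenius_norm_mul_le hM hE hW
    _ ≤ √2 * ((M * Matrix.fromBlocks S 0 0 S').trace / lam / √(lambdaMin M)) := by
        gcongr
        rwa [le_div_iff₀' hl0]
    _ = bisimBound S S' M lam := by
        rw [bisimBound, div_div, mul_div_assoc]

lemma norm_sub_le_bisimHet [NeZero dx] {T T' : LQRTask dx du} {K : Matrix (Fin du) (Fin dx) ℝ}
    (hK : K ∈ T.stabilizing) (hK' : K ∈ T'.stabilizing) {S S' : Matrix (Fin dx) (Fin dx) ℝ}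
    (hS : S.PosSemidef) (hS' : S'.PosSemidef) :
    ‖T.gradFactor K * lyapSum (T.closedLoop K) S -
        T'.gradFactor K * lyapSum (T'.closedLoop K) S'‖ ≤ bisimHet T T' S S' K := by
  obtain ⟨M, lam, h⟩ := exists_bisimFeasible hK hK'
  refine le_csInf ⟨_, M, lam, h, rfl⟩ ?_
  rintro _ ⟨M, lam, h, rfl⟩
  exact h.norm_sub_le hK hK' hS hS'

/-- Gradient domination: the suboptimality gap is at most
`‖Σ_{K'}‖ ‖E_K‖_F² / (4 σ_min(R))`. Complete the square in the cost difference formula. -/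
lemma LQRTask.trace_cost_sub_le (hdu : 0 < du) (T : LQRTask dx du)
    {K K' : Matrix (Fin du) (Fin dx) ℝ} {S : Matrix (Fin dx) (Fin dx) ℝ}
    (hS : S.PosSemidef) (hK : K ∈ T.stabilizing) (hK' : K' ∈ T.stabilizing) :
    (T.stageCost K * lyapSum (T.closedLoop K) S).trace -
        (T.stageCost K' * lyapSum (T.closedLoop K') S).trace ≤
      spectralNorm2 (lyapSum (T.closedLoop K') S) * ‖T.gradFactor K‖ ^ 2 /
        (4 * sigmaMin T.R) := by
  have hσ := sigmaMin_pos hdu T.posDef_R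
  set σ := sigmaMin T.R
  have hform := T.trace_cost_sub hS hK hK'
  have hW := (powDecay_closedLoop hK').posSemidef_lyapSum hS
  set W := lyapSum (T.closedLoop K') S
  set E := T.gradFactor K
  set Δ := K' - K
  set P := T.lyapunovSol K
  have hP := T.posSemidef_lyapunovSol hK
  have hquad : ∀ v : Fin dx → ℝ, 0 ≤ v ⬝ᵥ ((Δᵀ * E + Δᵀ * (T.R + T.Bᵀ * P * T.B) * Δ +
      (4 * σ)⁻¹ • (Eᵀ * E)) *ᵥ v) := fun v => by
    set d := Δ *ᵥ v
    set e := E *ᵥ v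
    have h1 : v ⬝ᵥ ((Δᵀ * E + Δᵀ * (T.R + T.Bᵀ * P * T.B) * Δ +
      (4 * σ)⁻¹ • (Eᵀ * E)) *ᵥ v) = d ⬝ᵥ e + (d ⬝ᵥ (T.R *ᵥ d) +
        (T.B *ᵥ d) ⬝ᵥ (P *ᵥ (T.B *ᵥ d))) + (4 * σ)⁻¹ * (e ⬝ᵥ e) := by
      simp only [Matrix.add_mulVec, Matrix.smul_mulVec, ← Matrix.mulVec_mulVec, dotProduct_add,
        dotProduct_smul, smul_eq_mul, Matrix.dotProduct_mulVec _ (_ᵀ), Matrix.vecMul_transpose,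
        Matrix.mulVec_add, d, e]
    have h2 := sigmaMin_mul_dotProduct_le T.posDef_R d
    have h3 := hP.dotProduct_mulVec_nonneg (T.B *ᵥ d)
    -- `σ |d|² + d·e + |e|² / (4σ) = σ |d + e / (2σ)|²`
    have h4 : 0 ≤ σ * (d ⬝ᵥ d) + d ⬝ᵥ e + (4 * σ)⁻¹ * (e ⬝ᵥ e) := by
      have h5 : 0 ≤ (d + (2 * σ)⁻¹ • e) ⬝ᵥ (d + (2 * σ)⁻¹ • e) := dotProduct_self_star_nonneg _
      simp only [add_dotProduct, dotProduct_add, smul_dotProduct, dotProduct_smul,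
        smul_eq_mul, dotProduct_comm e d] at h5
      have h6 := mul_nonneg hσ.le h5
      refine h6.trans_eq ?_
      field_simp
      ring
    rw [h1]
    simp only [star_trivial] at h3
    linarith
  have htr := trace_mul_nonneg hquad hW
  rw [add_mul, Matrix.trace_add, ← hform, Matrix.smul_mul, Matrix.trace_smul, smul_eq_mul] at htr
  have hEW : (Eᵀ * E * W).trace ≤ spectralNorm2 W * ‖E‖ ^ 2 := by
    rw [Matrix.trace_mul_comm, trace_mul_transpose_mul_self, frobenius_norm_sq, Finset.mul_sum]
    exact Finset.sum_le_sum fun k _ => dotProduct_mulVec_le_spectralNorm2 W (E k)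
  rw [div_eq_inv_mul]
  have := mul_le_mul_of_nonneg_left hEW (show 0 ≤ (4 * σ)⁻¹ by positivity)
  linarith

/-- Since `Σ_K ⪰ Σ₀ ⪰ λ_min(Σ₀) I`, right multiplication by `Σ_K` expands the Frobenius norm by at
least `λ_min(Σ₀)`. -/
lemma lambdaMin_mul_norm_le (hdx : 0 < dx) {A S : Matrix (Fin dx) (Fin dx) ℝ} (hA : PowDecay A)
    (hS : S.PosDef) (E : Matrix (Fin du) (Fin dx) ℝ) :
    lambdaMin S * ‖E‖ ≤ ‖E * lyapSum A S‖ := by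
  have : Nonempty (Fin dx) := ⟨⟨0, hdx⟩⟩
  have hlm := lambdaMin_pos hS
  have hW := hA.posSemidef_lyapSum hS.posSemidef
  have hsub := hA.posSemidef_lyapSum_sub hS.posSemidef
  set W := lyapSum A S
  set lm := lambdaMin S
  have hWt : Wᵀ = W := hW.isHermitian
  refine le_of_sq_le_sq ?_ (norm_nonneg _)
  rw [mul_pow, frobenius_norm_sq, frobenius_norm_sq, Finset.mul_sum]
  refine Finset.sum_le_sum fun k _ => ?_
  have hrow : (E * W) k = W *ᵥ E k := by
    rw [Matrix.mul_apply_eq_vecMul, ← Matrix.vecMul_transpose, hWt]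
  rw [hrow]
  have h1 := lambdaMin_mul_dotProduct_le hS.isHermitian (E k)
  have h2 := hsub.dotProduct_mulVec_nonneg (E k)
  simp only [Matrix.sub_mulVec, dotProduct_sub, star_trivial, sub_nonneg] at h2
  -- expand `0 ≤ |W e - lm e|²` and use `lm |e|² ≤ e · W e`
  have h3 : 0 ≤ (W *ᵥ E k - lm • E k) ⬝ᵥ (W *ᵥ E k - lm • E k) := dotProduct_self_star_nonneg _
  simp only [sub_dotProduct, dotProduct_sub, smul_dotProduct, dotProduct_smul, smul_eq_mul,
    dotProduct_comm (W *ᵥ E k) (E k)] at h3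
  nlinarith [mul_le_mul_of_nonneg_left (h1.trans h2) hlm.le]

lemma norm_gradient_le_avgBisimHet [NeZero dx] {N : ℕ} {T : Fin N → LQRTask dx du}
    {K : Matrix (Fin du) (Fin dx) ℝ} (hK : K ∈ commonStabilizing T)
    {S : Fin N → Matrix (Fin dx) (Fin dx) ℝ} (hS : ∀ i, (S i).PosSemidef)
    (hzero : ∑ i, (T i).gradFactor K * lyapSum ((T i).closedLoop K) (S i) = 0) (i : Fin N) :
    ‖(T i).gradFactor K * lyapSum ((T i).closedLoop K) (S i)‖ ≤ avgBisimHet T S i K := by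
  have hKi : ∀ i, K ∈ (T i).stabilizing := Set.mem_iInter.1 hK
  set g : Fin N → Matrix (Fin du) (Fin dx) ℝ :=
    fun j => (T j).gradFactor K * lyapSum ((T j).closedLoop K) (S j) with hg
  change ‖g i‖ ≤ _
  have hN : 0 < N := i.pos
  have hN' : (0 : ℝ) < N := by exact_mod_cast hN
  have hsum : (N : ℝ) • g i = ∑ j ∈ Finset.univ.erase i, (g i - g j) := by
    rw [Finset.sum_erase _ (sub_self _), Finset.sum_sub_distrib, hzero, sub_zero]
    simp [Nat.cast_smul_eq_nsmul]
  have h1 : (N : ℝ) * ‖g i‖ ≤ ∑ j ∈ Finset.univ.erase i, bisimHet (T i) (T j) (S i) (S j) K := by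
    have h2 : ‖(N : ℝ) • g i‖ = N * ‖g i‖ := by rw [norm_smul]; simp
    rw [← h2, hsum]
    exact (norm_sum_le _ _).trans (Finset.sum_le_sum fun j _ =>
      norm_sub_le_bisimHet (hKi i) (hKi j) (hS i) (hS j))
  rw [avgBisimHet, one_div, ← div_eq_inv_mul, le_div_iff₀' hN']
  exact h1

theorem theorem2 {N dx du : ℕ} {Ω : Type*} [MeasurableSpace Ω]
    (μ : Measure Ω) [IsProbabilityMeasure μ]
    (T : Fin N → LQRTask dx du)
    (x₀ : Fin N → Ω → Fin dx → ℝ)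
    (hL2 : ∀ i, MemLp (x₀ i) 2 μ)
    (hmean : ∀ i, ∫ ω, x₀ i ω ∂μ = 0)
    (hcov : ∀ i, (covMat μ (x₀ i)).PosDef)
    (Kstar : Matrix (Fin du) (Fin dx) ℝ)
    (hKstar : Kstar ∈ commonStabilizing T)
    (hKstar_min : IsMinOn (avgCost T μ x₀) (commonStabilizing T) Kstar)
    (i : Fin N)
    (Kopt : Matrix (Fin du) (Fin dx) ℝ)
    (hKopt : Kopt ∈ (T i).stabilizing)
    (hKopt_min : IsMinOn ((T i).cost μ (x₀ i)) (T i).stabilizing Kopt) :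
    (T i).cost μ (x₀ i) Kstar - (T i).cost μ (x₀ i) Kopt ≤
      2 * spectralNorm2 ((T i).stateCov μ (x₀ i) Kopt) *
          avgBisimHet T (fun j => covMat μ (x₀ j)) i Kstar ^ 2 /
        (lambdaMin (covMat μ (x₀ i)) ^ 2 * sigmaMin (T i).R) := by
  have hnorm : 0 ≤ spectralNorm2 ((T i).stateCov μ (x₀ i) Kopt) := norm_nonneg _
  -- without states or without inputs there is only one controller
  rcases Nat.eq_zero_or_pos dx with rfl | hdx
  · rw [Subsingleton.elim Kstar Kopt, sub_self]
    have : 0 ≤ sigmaMin (T i).R := LinearMap.singularValues_nonneg _ _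
    positivity
  rcases Nat.eq_zero_or_pos du with rfl | hdu
  · rw [Subsingleton.elim Kstar Kopt, sub_self]
    have : 0 ≤ sigmaMin (T i).R := LinearMap.singularValues_nonneg _ _
    positivity
  have : NeZero dx := ⟨hdx.ne'⟩
  have : Nonempty (Fin dx) := ⟨⟨0, hdx⟩⟩
  have hKi : ∀ j, Kstar ∈ (T j).stabilizing := Set.mem_iInter.1 hKstar
  have hN : (0 : ℝ) < N := by exact_mod_cast i.pos
  have hmin : IsMinOn (fun K => ∑ j, ((T j).stageCost K *
      lyapSum ((T j).closedLoop K) (covMat μ (x₀ j))).trace) (commonStabilizing T) Kstar := by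
    have havg : ∀ K ∈ commonStabilizing T, avgCost T μ x₀ K = (1 / (N : ℝ)) *
        ∑ j, ((T j).stageCost K * lyapSum ((T j).closedLoop K) (covMat μ (x₀ j))).trace :=
      fun K hK => by
        rw [avgCost]
        congr 1
        exact Finset.sum_congr rfl fun j _ =>
          (T j).cost_eq_trace (hL2 j) (hmean j) (Set.mem_iInter.1 hK j)
    refine isMinOn_iff.2 fun K hK => ?_
    have h := isMinOn_iff.1 hKstar_min K hK
    rw [havg _ hKstar, havg _ hK] at h
    exact le_of_mul_le_mul_left h (by positivity)
  have hpsd : ∀ j, (covMat μ (x₀ j)).PosSemidef := fun j => (hcov j).posSemidef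
  have hb := norm_gradient_le_avgBisimHet hKstar hpsd
    (sum_gradFactor_mul_lyapSum_eq_zero hKstar hpsd hmin) i
  have hE := lambdaMin_mul_norm_le hdx (LQRTask.powDecay_closedLoop (hKi i)) (hcov i)
    ((T i).gradFactor Kstar)
  have hdom := (T i).trace_cost_sub_le hdu (hpsd i) (hKi i) hKopt
  rw [← (T i).cost_eq_trace (hL2 i) (hmean i) hKopt,
    ← (T i).cost_eq_trace (hL2 i) (hmean i) (hKi i),
    ← (T i).stateCov_eq_lyapSum (hL2 i) (hmean i) hKopt] at hdom
  have hlm := lambdaMin_pos (hcov i)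
  have hσ := sigmaMin_pos hdu (T i).posDef_R
  set b := avgBisimHet T (fun j => covMat μ (x₀ j)) i Kstar
  set lm := lambdaMin (covMat μ (x₀ i))
  set σ := sigmaMin (T i).R
  set s := spectralNorm2 ((T i).stateCov μ (x₀ i) Kopt)
  set e := ‖(T i).gradFactor Kstar‖
  have he : 0 ≤ e := norm_nonneg _
  have hsq : e ^ 2 ≤ b ^ 2 / lm ^ 2 := by
    rw [le_div_iff₀' (by positivity), ← mul_pow]
    exact pow_le_pow_left₀ (by positivity) (hE.trans hb) 2
  calc (T i).cost μ (x₀ i) Kstar - (T i).cost μ (x₀ i) Kopt ≤ s * e ^ 2 / (4 * σ) := hdom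
    _ ≤ s * (b ^ 2 / lm ^ 2) / (4 * σ) := by gcongr
    _ = (1 / 4) * (s * b ^ 2 / (lm ^ 2 * σ)) := by field_simp
    _ ≤ 2 * (s * b ^ 2 / (lm ^ 2 * σ)) := by
        gcongr
        norm_num
    _ = 2 * s * b ^ 2 / (lm ^ 2 * σ) := by ring

end Gradient

end
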